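/- Let $X_g$ be the union of the two coordinate axes of $\mathbb{R}^2$ with the gluing diffeology, that is, the quotient diffeology from $(\mathbb{R}\times\{0\})\sqcup(\{0\}\times\mathbb{R})$ with the two origins identified; equivalently, the diffeology generated by the inclusions $t\mapsto(t,0)$ and $t\mapsto(0,t)$ of the two axes. For a diffeological space $X$ and $k\ge 0$, let $\Omega^k(X)=\lim_{p:U\to X}\Omega^k(U)$ be the vector space of differential $k$-forms on $X$, i.e. of families $\omega_p\in\Omega^k(U)$, indexed by the plots $p:U\to X$, such that $f^*\omega_q=\omega_p$ whenever $f$ is smooth and $q\circ f=p$. Let $T^{\mathrm{dvs}}X\to X$ be the internal tangent bundle: its fibre $T_xX$ is the colimit of $T_0U$ over the pointed plots $(U,0)\to(X,x)$, and its total space has the smallest diffeology making it a diffeological vector pseudo-bundle over $X$ and making $Tp:TU\to T^{\mathrm{dvs}}X$ smooth for all plots $p:U\to X$. Let $\widetilde\Omega^k(X)=\Gamma\big((\bigwedge^kT^{\mathrm{dvs}}X)^*\to X\big)$ be the vector space of smooth sections of the dual of the $k$-th exterior power of this diffeological vector pseudo-bundle. Let $\phi:\widetilde\Omega^k(X)\to\Omega^k(X)$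 be the linear map with $$\phi(s)_p(u)(v_1,\dots,v_k)=s(p(u))\big(Tp(u,v_1)\wedge\cdots\wedge Tp(u,v_k)\big)$$ for every plot $p:U\to X$, $u\in U$ and $v_1,\dots,v_k\in T_uU$. Call $X$ weakly filtered if, for every $x\in X$, every finite collection of pointed plots $(U_i,0)\to(X,x)$ factors, via germs at $0$ of pointed smooth maps, through a common pointed plot. Then $\widetilde\Omega^2(X_g)$ is $1$-dimensional, while $\Omega^2(X_g)=0$. In particular, there is no injective linear map $\widetilde\Omega^2(X_g)\to\Omega^2(X_g)$. Moreover, $X_g$ is not weakly filtered, and $\phi:\widetilde\Omega^2(X_g)\to\Omega^2(X_g)$ is not injective; so $\phi$ can fail to be injective for spaces that are not weakly filtered. -/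

import Mathlib

noncomputable section

namespace Diffeology

open scoped ContDiff

universe u v

/-! Following Mathlib, plots have the whole of `ℝⁿ` as domain. Since every point of an open subset
of `ℝⁿ` has arbitrarily small neighbourhoods diffeomorphic to `ℝⁿ` and plots are local, such plots
determine the diffeology, and limits and colimits of local data over them agree with those over
plots defined on open subsets of `ℝⁿ`. -/

/-- The Euclidean space `ℝⁿ`. -/
abbrev Euc (n : ℕ) := EuclideanSpace ℝ (Fin n)

/-! ### Diffeological vector pseudo-bundles -/

section PseudoBundle

variable {B : Type u} [DiffeologicalSpace B]

/-- A diffeology on the total space `Σ b, E b` of a family of real vector spaces makes the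
projection to `B` a diffeological vector pseudo-bundle if the projection, the fibrewise addition
`E ×_B E → E`, the scalar multiplication `ℝ × E → E` and the zero section are smooth. A plot of
`E ×_B E` is a pair of plots of `E` over the same map `q` to `B`. -/
structure IsVecPseudoBundle {E : B → Type v} [∀ b, AddCommGroup (E b)] [∀ b, Module ℝ (E b)]
    (d : DiffeologicalSpace (Σ b, E b)) : Prop where
  proj : ∀ {n : ℕ} (w : Euc n → Σ b, E b), IsPlot w → IsPlot (fun a => (w a).1)
  add : ∀ {n : ℕ} (q : Euc n → B) (e₁ e₂ : ∀ a, E (q a)),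
    IsPlot (fun a => (⟨q a, e₁ a⟩ : Σ b, E b)) → IsPlot (fun a => (⟨q a, e₂ a⟩ : Σ b, E b)) →
      IsPlot (fun a => (⟨q a, e₁ a + e₂ a⟩ : Σ b, E b))
  smul : ∀ {n : ℕ} (q : Euc n → B) (r : Euc n → ℝ) (e : ∀ a, E (q a)),
    ContDiff ℝ ∞ r → IsPlot (fun a => (⟨q a, e a⟩ : Σ b, E b)) →
      IsPlot (fun a => (⟨q a, r a • e a⟩ : Σ b, E b))
  zero : ∀ {n : ℕ} (q : Euc n → B), IsPlot q → IsPlot (fun a => (⟨q a, 0⟩ : Σ b, E b))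

/-- Dvsification: the smallest diffeology on the total space that contains the given one and
makes the projection a diffeological vector pseudo-bundle. -/
@[reducible]
def dvsification {E : B → Type v} [∀ b, AddCommGroup (E b)] [∀ b, Module ℝ (E b)]
    (d : DiffeologicalSpace (Σ b, E b)) : DiffeologicalSpace (Σ b, E b) :=
  sInf {d' | d ≤ d' ∧ IsVecPseudoBundle d'}

/-- The largest diffeology on a total space for which the projection is smooth. -/
@[reducible]
def coarseOver (E : B → Type v) : DiffeologicalSpace (Σ b, E b) where
  plots _ := {w | IsPlot (fun a => (w a).1)}
  constant_plots _ := isPlot_const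
  plot_reparam hp hf := DiffeologicalSpace.plot_reparam (X := B) hp hf
  locality {n p} h := DiffeologicalSpace.locality (p := fun a => (p a).1) h

theorem le_dvsification {E : B → Type v} [∀ b, AddCommGroup (E b)] [∀ b, Module ℝ (E b)]
    (d : DiffeologicalSpace (Σ b, E b)) : d ≤ dvsification d :=
  le_sInf fun _ h => h.1

theorem isVecPseudoBundle_dvsification {E : B → Type v} [∀ b, AddCommGroup (E b)]
    [∀ b, Module ℝ (E b)] (d : DiffeologicalSpace (Σ b, E b)) (hd : d ≤ coarseOver E) :
    IsVecPseudoBundle (dvsification d) where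
  proj w hw := by
    have hc : IsVecPseudoBundle (coarseOver E) :=
      ⟨fun _ h => h, fun _ _ _ h _ => h, fun _ _ _ _ h => h, fun _ h => h⟩
    exact (DiffeologicalSpace.isPlot_sInf_iff.1 hw) _ ⟨hd, hc⟩
  add q e₁ e₂ h₁ h₂ := DiffeologicalSpace.isPlot_sInf_iff.2 fun d' hd' =>
    hd'.2.add q e₁ e₂ (DiffeologicalSpace.isPlot_sInf_iff.1 h₁ d' hd')
      (DiffeologicalSpace.isPlot_sInf_iff.1 h₂ d' hd')
  smul q r e hr h := DiffeologicalSpace.isPlot_sInf_iff.2 fun d' hd' =>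
    hd'.2.smul q r e hr (DiffeologicalSpace.isPlot_sInf_iff.1 h d' hd')
  zero q hq := DiffeologicalSpace.isPlot_sInf_iff.2 fun _ hd' => hd'.2.zero q hq

variable (B) in
/-- A diffeological vector pseudo-bundle over `B`. -/
structure VecPseudoBundle where
  /-- The fibre over a point. -/
  Fibre : B → Type v
  [addCommGroup : ∀ b, AddCommGroup (Fibre b)]
  [module : ∀ b, Module ℝ (Fibre b)]
  /-- The diffeology of the total space. -/
  diffeology : DiffeologicalSpace (Σ b, Fibre b)
  isVecPseudoBundle : IsVecPseudoBundle diffeology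

attribute [instance] VecPseudoBundle.addCommGroup VecPseudoBundle.module

namespace VecPseudoBundle

/-- The total space of a diffeological vector pseudo-bundle. -/
abbrev Total (E : VecPseudoBundle.{u, v} B) := Σ b, E.Fibre b

instance (E : VecPseudoBundle.{u, v} B) : DiffeologicalSpace E.Total := E.diffeology

/-- The vector space `Γ(E)` of smooth sections. -/
def sections (E : VecPseudoBundle.{u, v} B) : Submodule ℝ (∀ b, E.Fibre b) where
  carrier := {s | DSmooth (fun b => (⟨b, s b⟩ : E.Total))}
  add_mem' {s t} hs ht n q hq :=
    E.isVecPseudoBundle.add q (fun a => s (q a)) (fun a => t (q a)) (hs n q hq) (ht n q hq)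
  zero_mem' _ q hq := E.isVecPseudoBundle.zero q hq
  smul_mem' c s hs n q hq :=
    E.isVecPseudoBundle.smul q (fun _ => c) (fun a => s (q a)) contDiff_const (hs n q hq)

/-! #### Exterior powers -/

/-- The maps `a ↦ e₁(a) ∧ ⋯ ∧ e_k(a)`, where `e₁, …, e_k` are plots of `E` over a common plot
`q` of `B`. -/
def wedgePlots (E : VecPseudoBundle.{u, v} B) (k : ℕ) :
    Set ((n : ℕ) × (Euc n → Σ b, ⋀[ℝ]^k (E.Fibre b))) :=
  {g | ∃ (n : ℕ) (q : Euc n → B) (e : ∀ a, Fin k → E.Fibre (q a)),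
    IsPlot q ∧ (∀ i, IsPlot (fun a => (⟨q a, e a i⟩ : E.Total))) ∧
      g = ⟨n, fun a => ⟨q a, exteriorPower.ιMulti ℝ k (e a)⟩⟩}

/-- The exterior power `⋀ᵏ E`. Its plots are locally the finite linear combinations, with smooth
coefficients, of wedge products of plots of `E` over the same plot of `B`. -/
def exterior (E : VecPseudoBundle.{u, v} B) (k : ℕ) : VecPseudoBundle.{u, v} B where
  Fibre b := ⋀[ℝ]^k (E.Fibre b)
  diffeology := dvsification (DiffeologicalSpace.generateFrom (E.wedgePlots k))
  isVecPseudoBundle := isVecPseudoBundle_dvsification _ <| by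
    rw [DiffeologicalSpace.generateFrom_le_iff]
    rintro n p ⟨m, q, e, hq, he, h⟩
    cases h
    exact hq

theorem isPlot_wedge (E : VecPseudoBundle.{u, v} B) (k : ℕ) {n : ℕ} (q : Euc n → B)
    (e : ∀ a, Fin k → E.Fibre (q a)) (hq : IsPlot q)
    (he : ∀ i, IsPlot (fun a => (⟨q a, e a i⟩ : E.Total))) :
    IsPlot (fun a => (⟨q a, exteriorPower.ιMulti ℝ k (e a)⟩ : (E.exterior k).Total)) :=
  DiffeologicalSpace.le_iff'.1
    (le_dvsification (DiffeologicalSpace.generateFrom (E.wedgePlots k))) _ _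
    (DiffeologicalSpace.isPlot_generatedFrom_of_mem ⟨n, q, e, hq, he, rfl⟩)

/-! #### Duals -/

/-- The smooth dual `L^∞(E_b, ℝ)` of a fibre, where the fibre has the subset diffeology. -/
def smoothDual (E : VecPseudoBundle.{u, v} B) (b : B) : Submodule ℝ (Module.Dual ℝ (E.Fibre b)) where
  carrier := {l | ∀ (n : ℕ) (e : Euc n → E.Fibre b),
    IsPlot (fun a => (⟨b, e a⟩ : E.Total)) → ContDiff ℝ ∞ (fun a => l (e a))}
  add_mem' hl hm n e he := (hl n e he).add (hm n e he)
  zero_mem' _ _ _ := contDiff_const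
  smul_mem' _ _ hl n e he := contDiff_const.smul (hl n e he)

/-- The diffeology of the dual bundle: `w : U → E^*` is a plot if its projection to `B` and the
map `U ×_B E → ℝ`, `(a, x) ↦ w(a)(x)`, are smooth. A plot of `U ×_B E` is a smooth map `g` to `U`
together with a plot of `E` over the same map to `B`. -/
@[reducible]
def dualDiffeology (E : VecPseudoBundle.{u, v} B) : DiffeologicalSpace (Σ b, E.smoothDual b) where
  plots n := {w | IsPlot (fun a => (w a).1) ∧
    ∀ (m : ℕ) (g : Euc m → Euc n) (e : ∀ c, E.Fibre (w (g c)).1), ContDiff ℝ ∞ g →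
      IsPlot (fun c => (⟨(w (g c)).1, e c⟩ : E.Total)) →
        ContDiff ℝ ∞ (fun c => (w (g c)).2.1 (e c))}
  constant_plots x := ⟨isPlot_const, fun m _ e _ he => x.2.2 m e he⟩
  plot_reparam {n m p f} hp hf := ⟨isPlot_reparam hp.1 hf,
    fun l g e hg he => hp.2 l (f ∘ g) e (hf.comp hg) he⟩
  locality {n p} h := by
    refine ⟨DiffeologicalSpace.locality fun x => ?_, fun m g e hg he => ?_⟩
    · obtain ⟨s, hs, hx, H⟩ := h x
      exact ⟨s, hs, hx, fun hf hf' => (H hf hf').1⟩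
    · refine IsPlot.contDiff (DiffeologicalSpace.locality fun x => ?_)
      obtain ⟨s, hs, hx, H⟩ := h (g x)
      refine ⟨g ⁻¹' s, hs.preimage hg.continuous, hx, fun {l f} hf hf' => ?_⟩
      exact ContDiff.isPlot ((H (f := g ∘ f) hf (hg.comp hf')).2 l id (fun c => e (f c))
        contDiff_id (isPlot_reparam he hf'))

/-- The dual bundle `E^*`. -/
def dual (E : VecPseudoBundle.{u, v} B) : VecPseudoBundle.{u, v} B where
  Fibre b := E.smoothDual b
  diffeology := E.dualDiffeology
  isVecPseudoBundle :=
    { proj := fun _ hw => hw.1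
      add := fun _ _ _ h₁ h₂ => ⟨h₁.1, fun m g e hg he =>
        (h₁.2 m g e hg he).add (h₂.2 m g e hg he)⟩
      smul := fun _ _ _ hr h => ⟨h.1, fun m g e hg he =>
        (hr.comp hg).smul (h.2 m g e hg he)⟩
      zero := fun _ hq => ⟨hq, fun _ _ _ _ _ => contDiff_const⟩ }

end VecPseudoBundle

end PseudoBundle

/-! ### The internal tangent bundle -/

section Tangent

variable (X : Type u) [DiffeologicalSpace X]

/-- The pointed plots `(ℝⁿ, 0) → (X, x)`. -/
structure PointedPlot (x : X) where
  /-- The dimension of the domain. -/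
  dim : ℕ
  /-- The underlying map. -/
  toFun : Euc dim → X
  isPlot : IsPlot toFun
  map_zero : toFun 0 = x

/-- The relations `(p, v) ∼ (q, f_* v)` for a morphism `f : p → q` of pointed plots. -/
def tangentRelations (x : X) : Submodule ℝ (Π₀ p : PointedPlot X x, Euc p.dim) :=
  open scoped Classical in
  Submodule.span ℝ {z | ∃ (p q : PointedPlot X x) (f : Euc p.dim → Euc q.dim) (v : Euc p.dim),
    ContDiff ℝ ∞ f ∧ f 0 = 0 ∧ q.toFun ∘ f = p.toFun ∧
      z = DFinsupp.single p v - DFinsupp.single q (fderiv ℝ f 0 v)}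

/-- The (internal) tangent space `T_x X`: the colimit of the vector spaces `T_0(ℝⁿ) = ℝⁿ` over the
category of pointed plots `(ℝⁿ, 0) → (X, x)`. -/
abbrev InternalTangentSpace (x : X) : Type u :=
  (Π₀ p : PointedPlot X x, Euc p.dim) ⧸ tangentRelations X x

variable {X}

/-- The structure map `p_* : T_0(ℝⁿ) → T_x X` of the colimit. -/
def PointedPlot.push {x : X} (p : PointedPlot X x) : Euc p.dim →ₗ[ℝ] InternalTangentSpace X x :=
  open scoped Classical in
  (tangentRelations X x).mkQ ∘ₗ DFinsupp.lsingle (M := fun p : PointedPlot X x => Euc p.dim) p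

theorem PointedPlot.push_comp {x : X} (p q : PointedPlot X x) (f : Euc p.dim → Euc q.dim)
    (hf : ContDiff ℝ ∞ f) (h0 : f 0 = 0) (h : q.toFun ∘ f = p.toFun) (v : Euc p.dim) :
    p.push v = q.push (fderiv ℝ f 0 v) :=
  (Submodule.Quotient.eq (tangentRelations X x)).2
    (Submodule.subset_span ⟨p, q, f, v, hf, h0, h, rfl⟩)

/-- The plot `p` recentred at the point `a` of its domain. -/
def recentre {n : ℕ} (p : Euc n → X) (hp : IsPlot p) (a : Euc n) : PointedPlot X (p a) where
  dim := n
  toFun c := p (c + a)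
  isPlot := isPlot_reparam (f := fun c => c + a) hp (contDiff_id.add contDiff_const)
  map_zero := by simp

/-- The linear map `T_a(ℝⁿ) = ℝⁿ → T_{p(a)} X` induced by a plot `p`. -/
def plotTangent {n : ℕ} (p : Euc n → X) (hp : IsPlot p) (a : Euc n) :
    Euc n →ₗ[ℝ] InternalTangentSpace X (p a) :=
  (recentre p hp a).push

variable (X)

/-- The plots of the form `Tp ∘ (a, v)`, where `p` is a plot of `X`, `Tp : T(ℝⁿ) → TX` is the
induced map and `(a, v)` is a plot of `T(ℝⁿ) = ℝⁿ × ℝⁿ`. -/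
def hectorPlots : Set ((m : ℕ) × (Euc m → Σ x : X, InternalTangentSpace X x)) :=
  {g | ∃ (n m : ℕ) (p : Euc n → X) (hp : IsPlot p) (a v : Euc m → Euc n),
    ContDiff ℝ ∞ a ∧ ContDiff ℝ ∞ v ∧
      g = ⟨m, fun c => ⟨p (a c), plotTangent p hp (a c) (v c)⟩⟩}

/-- The internal tangent bundle `T^dvs X`: the dvsification of Hector's diffeology, which is the
diffeology generated by the maps `Tp`. -/
def tangentBundle : VecPseudoBundle.{u, u} X where
  Fibre x := InternalTangentSpace X x
  diffeology := dvsification (DiffeologicalSpace.generateFrom (hectorPlots X))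
  isVecPseudoBundle := isVecPseudoBundle_dvsification _ <| by
    rw [DiffeologicalSpace.generateFrom_le_iff]
    rintro l w ⟨n, m, p, hp, a, v, ha, hv, h⟩
    cases h
    exact isPlot_reparam hp ha

variable {X} in
theorem isPlot_plotTangent {n : ℕ} (p : Euc n → X) (hp : IsPlot p) (v : Euc n) :
    IsPlot (fun a => (⟨p a, plotTangent p hp a v⟩ : (tangentBundle X).Total)) :=
  DiffeologicalSpace.le_iff'.1
    (le_dvsification (DiffeologicalSpace.generateFrom (hectorPlots X))) _ _
    (DiffeologicalSpace.isPlot_generatedFrom_of_mem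
      ⟨n, n, p, hp, id, fun _ => v, contDiff_id, contDiff_const, rfl⟩)

end Tangent

/-! ### The two notions of differential form -/

section Forms

variable (k : ℕ) (X : Type u) [DiffeologicalSpace X]

/-- `Ω̃ᵏ(X)`: the smooth sections of the dual of the `k`-th exterior power of `T^dvs X`. -/
abbrev TangentForms : Submodule ℝ (∀ x, (((tangentBundle X).exterior k).dual).Fibre x) :=
  (((tangentBundle X).exterior k).dual).sections

/-- The plots of `X`. -/
structure Plot where
  /-- The dimension of the domain. -/
  dim : ℕ
  /-- The underlying map. -/
  toFun : Euc dim → X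
  isPlot : IsPlot toFun

/-- `Ωᵏ(X)`: the limit of the spaces `Ωᵏ(ℝⁿ)` of smooth `k`-forms over the category of plots
`ℝⁿ → X`, that is, the families `ω_p ∈ Ωᵏ(ℝⁿ)` with `f^* ω_q = ω_p` whenever `q ∘ f = p`. -/
def DifferentialForms :
    Submodule ℝ (∀ p : Plot X, Euc p.dim → (Euc p.dim [⋀^Fin k]→L[ℝ] ℝ)) where
  carrier := {α | (∀ p, ContDiff ℝ ∞ (α p)) ∧
    ∀ (p q : Plot X) (f : Euc p.dim → Euc q.dim), ContDiff ℝ ∞ f → q.toFun ∘ f = p.toFun →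
      ∀ a, (α q (f a)).compContinuousLinearMap (fderiv ℝ f a) = α p a}
  add_mem' {α β} hα hβ := by
    refine ⟨fun p => (hα.1 p).add (hβ.1 p), fun p q f hf h a => ?_⟩
    have h1 := hα.2 p q f hf h a
    have h2 := hβ.2 p q f hf h a
    simp only [Pi.add_apply, ← h1, ← h2]
    rfl
  zero_mem' := ⟨fun _ => contDiff_const, fun _ _ _ _ _ _ => rfl⟩
  smul_mem' c α hα := by
    refine ⟨fun p => contDiff_const (c := c).smul (hα.1 p), fun p q f hf h a => ?_⟩
    have h1 := hα.2 p q f hf h a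
    simp only [Pi.smul_apply, ← h1]
    rfl

end Forms

/-! ### The comparison map -/

section Comparison

variable {k : ℕ} {X : Type u} [DiffeologicalSpace X]

/-- Naturality of the maps induced on tangent spaces by plots. -/
theorem plotTangent_comp {m n : ℕ} (p : Euc m → X) (hp : IsPlot p) (q : Euc n → X) (hq : IsPlot q)
    (f : Euc m → Euc n) (hf : ContDiff ℝ ∞ f) (h : q ∘ f = p) (a v : Euc m) :
    (⟨p a, plotTangent p hp a v⟩ : Σ x : X, InternalTangentSpace X x) =
      ⟨q (f a), plotTangent q hq (f a) (fderiv ℝ f a v)⟩ := by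
  subst h
  congr 1
  have key : fderiv ℝ (fun c => f (c + a) - f a) 0 = fderiv ℝ f a := by
    rw [fderiv_sub_const, fderiv_comp_add_right, zero_add]
  have h0 : (fun c : Euc m => f (c + a) - f a) 0 = 0 :=
    (congrArg (fun c => f c - f a) (zero_add a)).trans (sub_self _)
  have h1 : (fun c : Euc n => q (c + f a)) ∘ (fun c : Euc m => f (c + a) - f a) =
      fun c : Euc m => q (f (c + a)) :=
    funext fun c => congrArg q (sub_add_cancel (f (c + a)) (f a))
  exact (PointedPlot.push_comp (recentre (q ∘ f) hp a) (recentre q hq (f a))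
    (fun c : Euc m => f (c + a) - f a)
    ((hf.comp (contDiff_id.add contDiff_const)).sub contDiff_const) h0 h1 v).trans
      (congrArg (recentre q hq (f a)).push (congrArg (fun l => l v) key))

theorem continuous_alternatingMap {n : ℕ} (g : Euc n [⋀^Fin k]→ₗ[ℝ] ℝ) : Continuous g := by
  have h : (g : (Fin k → Euc n) → ℝ) = fun v => ∑ r : Fin k → Fin n,
      (∏ i, v i (r i)) • g (fun i => EuclideanSpace.basisFun (Fin n) ℝ (r i)) := by
    funext v
    conv_lhs => rw [show v = fun i => ∑ j, v i j • EuclideanSpace.basisFun (Fin n) ℝ j from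
      funext fun i => by
        simpa using ((EuclideanSpace.basisFun (Fin n) ℝ).sum_repr (v i)).symm]
    rw [← AlternatingMap.coe_multilinearMap, MultilinearMap.map_sum]
    simp only [MultilinearMap.map_smul_univ]
  rw [h]
  fun_prop

theorem contDiff_alternatingMap {m n : ℕ} (F : Euc m → (Euc n [⋀^Fin k]→L[ℝ] ℝ))
    (h : ∀ v : Fin k → Euc n, ContDiff ℝ ∞ (fun a => F a v)) : ContDiff ℝ ∞ F := by
  let ev : (Euc n [⋀^Fin k]→L[ℝ] ℝ) →ₗ[ℝ] ((Fin k → Fin n) → ℝ) :=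
    { toFun := fun g r => g (fun i => EuclideanSpace.basisFun (Fin n) ℝ (r i))
      map_add' := fun _ _ => rfl
      map_smul' := fun _ _ => rfl }
  have hev : LinearMap.ker ev = ⊥ := by
    refine LinearMap.ker_eq_bot.2 fun g₁ g₂ hg => ?_
    refine ContinuousAlternatingMap.toAlternatingMap_injective
      ((EuclideanSpace.basisFun (Fin n) ℝ).toBasis.ext_alternating fun r _ => ?_)
    simpa [ev] using congrFun hg r
  obtain ⟨L, hL⟩ := ev.exists_leftInverse_of_injective hev
  have hF : F = fun a => LinearMap.toContinuousLinearMap L (ev (F a)) := by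
    funext a
    exact (LinearMap.congr_fun hL (F a)).symm
  rw [hF]
  exact (LinearMap.toContinuousLinearMap L).contDiff.comp (contDiff_pi.2 fun r => h _)

/-- The `k`-form `(v₁, …, v_k) ↦ s_{p(a)}(Tp(a, v₁) ∧ ⋯ ∧ Tp(a, v_k))` at the point `a` of the
domain of the plot `p`. -/
def pullbackForm (s : ∀ x, (((tangentBundle X).exterior k).dual).Fibre x) (p : Plot X)
    (a : Euc p.dim) : Euc p.dim [⋀^Fin k]→L[ℝ] ℝ :=
  { (((s (p.toFun a)).1.compAlternatingMap (exteriorPower.ιMulti ℝ k)).compLinearMap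
      (plotTangent p.toFun p.isPlot a)) with
    cont := continuous_alternatingMap (((s (p.toFun a)).1.compAlternatingMap
      (exteriorPower.ιMulti ℝ k)).compLinearMap (plotTangent p.toFun p.isPlot a)) }

theorem pullbackForm_apply (s : ∀ x, (((tangentBundle X).exterior k).dual).Fibre x) (p : Plot X)
    (a : Euc p.dim) (v : Fin k → Euc p.dim) :
    pullbackForm s p a v = (s (p.toFun a)).1
      (exteriorPower.ιMulti ℝ k fun i => plotTangent p.toFun p.isPlot a (v i)) := rfl

theorem pullbackForm_mem (s : TangentForms k X) : pullbackForm s.1 ∈ DifferentialForms k X := by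
  refine show _ ∧ _ from ⟨fun p => contDiff_alternatingMap _ fun v => ?_, fun p q f hf h a => ?_⟩
  · have hs := (s.2 p.dim p.toFun p.isPlot).2 p.dim id
      (fun c => exteriorPower.ιMulti ℝ k fun i => plotTangent p.toFun p.isPlot c (v i)) contDiff_id
    exact hs ((tangentBundle X).isPlot_wedge k p.toFun _ p.isPlot
      fun i => isPlot_plotTangent p.toFun p.isPlot (v i))
  · ext v
    have key : ∀ i, (⟨p.toFun a, plotTangent p.toFun p.isPlot a (v i)⟩ :
        Σ x : X, InternalTangentSpace X x) = ⟨q.toFun (f a), plotTangent q.toFun q.isPlot (f a)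
          (fderiv ℝ f a (v i))⟩ :=
      fun i => plotTangent_comp _ p.isPlot _ q.isPlot f hf h a (v i)
    have gen : ∀ (x y : X) (e : Fin k → InternalTangentSpace X x)
        (e' : Fin k → InternalTangentSpace X y), x = y →
        (∀ i, (⟨x, e i⟩ : Σ x : X, InternalTangentSpace X x) = ⟨y, e' i⟩) →
          (s.1 x).1 (exteriorPower.ιMulti ℝ k e) = (s.1 y).1 (exteriorPower.ιMulti ℝ k e') := by
      rintro x y e e' rfl he
      have : e = e' := funext fun i => by simpa using he i
      rw [this]
    exact (gen _ _ _ _ (congrFun h a).symm key).symm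

variable (k X) in
/-- The comparison map `φ : Ω̃ᵏ(X) → Ωᵏ(X)`: the component of `φ(s)` at a plot `p` is the pullback
of `s` along `⋀ᵏ Tp : ⋀ᵏ T(ℝⁿ) → ⋀ᵏ T^dvs X`. -/
def comparison : TangentForms k X →ₗ[ℝ] DifferentialForms k X where
  toFun s := ⟨pullbackForm s.1, pullbackForm_mem s⟩
  map_add' _ _ := rfl
  map_smul' _ _ := rfl

end Comparison

/-! ### Weakly filtered spaces -/

/-- `X` is weakly filtered if, for each `x`, every finite collection of pointed plots
`(ℝⁿ, 0) → (X, x)` factors through a common pointed plot, via germs at `0` of pointed smooth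
maps. -/
def WeaklyFiltered (X : Type u) [DiffeologicalSpace X] : Prop :=
  ∀ (x : X) (S : Finset (PointedPlot X x)), ∃ q : PointedPlot X x, ∀ p ∈ S,
    ∃ (U : Set (Euc p.dim)) (f : Euc p.dim → Euc q.dim), IsOpen U ∧ 0 ∈ U ∧
      ContDiffOn ℝ ∞ f U ∧ f 0 = 0 ∧ ∀ a ∈ U, q.toFun (f a) = p.toFun a

/-! ### The axes with the gluing diffeology -/

/-- The union of the two coordinate axes of `ℝ²`. -/
def GluedAxes : Type := {z : ℝ × ℝ // z.1 = 0 ∨ z.2 = 0}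

/-- The inclusion of the first axis. -/
def GluedAxes.inl (t : ℝ) : GluedAxes := ⟨(t, 0), Or.inr rfl⟩

/-- The inclusion of the second axis. -/
def GluedAxes.inr (t : ℝ) : GluedAxes := ⟨(0, t), Or.inl rfl⟩

/-- The gluing diffeology on `X_g`, i.e. the quotient diffeology from the disjoint union of the two
axes: it is generated by the inclusions of the two axes. -/
instance : DiffeologicalSpace GluedAxes :=
  DiffeologicalSpace.generateFrom
    {⟨1, fun t => GluedAxes.inl (t 0)⟩, ⟨1, fun t => GluedAxes.inr (t 0)⟩}

end Diffeology

end

noncomputable section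

namespace Diffeology

open scoped ContDiff Topology

universe u v

/-! ### Localisation of plots -/

/-! Near each point of its domain, a plot of the glued axes stays in a single axis
(`mem_locallyAxial`). Both halves of the statement rest on this.

A form on plots sees only one plot at a time. Locally each plot factors through a line, where
2-forms vanish, so `differentialForm_eq_zero` holds. For the same reason no pointed plot at the
origin can carry both axes, and weak filteredness fails there.

The tangent space at the origin is instead a colimit over all pointed plots. It is spanned by the
two axis directions, which no single plot sees together; away from the origin the tangent space is a
line. A section of the dual of `⋀²` is thus determined by its value on the wedge of the two
directions at the origin (`tangentForm_eq_zero`), which bounds the dimension by 1.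

For the lower bound, `dx ∧ dy` takes the value 1 there. The point to check is its smoothness on the
dvsified bundles: a fibrewise linear function need only be tested on generators
(`contDiff_of_isPlot_dvsification`). No linear map from a one-dimensional space to zero is
injective, in particular not the comparison map. -/

/-- Smooth self-maps of `ℝⁿ` with values in a given neighbourhood of `a` that are the identity
near `a`. -/
theorem exists_contDiff_eventuallyEq_id {n : ℕ} (a : Euc n) {U : Set (Euc n)} (hU : U ∈ 𝓝 a) :
    ∃ f : Euc n → Euc n, ContDiff ℝ ∞ f ∧ (∀ c, f c ∈ U) ∧ f =ᶠ[𝓝 a] id := by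
  obtain ⟨r, hr, hrU⟩ := Metric.mem_nhds_iff.1 hU
  let b : ContDiffBump a := ⟨r / 2, r, half_pos hr, half_lt_self hr⟩
  -- The displacement from `a` is scaled by a bump function: it is kept where the bump is 1, shrunk
  -- inside the ball of radius `r`, and killed outside, where the value is `a`.
  refine ⟨fun c => a + b c • (c - a),
    contDiff_const.add (b.contDiff.smul (contDiff_id.sub contDiff_const)),
    fun c => hrU ?_, ?_⟩
  · rw [Metric.mem_ball, dist_eq_norm, add_sub_cancel_left, norm_smul, Real.norm_of_nonneg b.nonneg]
    rcases lt_or_ge (dist c a) r with h | h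
    · rw [dist_eq_norm] at h
      exact (mul_le_of_le_one_left (norm_nonneg _) b.le_one).trans_lt h
    · rw [b.zero_of_le_dist h, zero_mul]
      exact hr
  · filter_upwards [b.eventuallyEq_one] with c hc
    simp [hc]

/-- The hypothesis has the shape of the `locality` axiom of a diffeology. Testing it on a map into
`s` that is the identity near `x` gives smoothness at `x`. -/
theorem contDiff_of_locally {m : ℕ} {h : Euc m → ℝ}
    (H : ∀ x, ∃ s : Set (Euc m), IsOpen s ∧ x ∈ s ∧ ∀ {l : ℕ} {f : Euc l → Euc m},
      (∀ c, f c ∈ s) → ContDiff ℝ ∞ f → ContDiff ℝ ∞ (h ∘ f)) : ContDiff ℝ ∞ h := by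
  refine contDiff_iff_contDiffAt.2 fun x => ?_
  obtain ⟨s, hs, hx, hf⟩ := H x
  obtain ⟨f, hf1, hf2, hf3⟩ := exists_contDiff_eventuallyEq_id x (hs.mem_nhds hx)
  refine (hf hf2 hf1).contDiffAt.congr_of_eventuallyEq ?_
  filter_upwards [hf3] with c hc
  simp [hc]

/-! ### Smoothness of fibrewise linear functions -/

section FibrewiseLinear

variable {B : Type u} [DiffeologicalSpace B] {E : B → Type v} [∀ b, AddCommGroup (E b)]
  [∀ b, Module ℝ (E b)]

/-- The largest diffeology on a total space for which the projection and a given fibrewise linear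
function are smooth. -/
@[reducible]
def smoothAlong (l : ∀ b, E b →ₗ[ℝ] ℝ) : DiffeologicalSpace (Σ b, E b) where
  plots _ := {w | IsPlot (fun a => (w a).1) ∧ ContDiff ℝ ∞ (fun a => l (w a).1 (w a).2)}
  constant_plots _ := ⟨isPlot_const, contDiff_const⟩
  plot_reparam hp hf := ⟨isPlot_reparam hp.1 hf, hp.2.comp hf⟩
  locality {n p} h := by
    refine ⟨DiffeologicalSpace.locality fun x => ?_, contDiff_of_locally fun x => ?_⟩
    · obtain ⟨s, hs, hx, H⟩ := h x
      exact ⟨s, hs, hx, fun hf hf' => (H hf hf').1⟩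
    · obtain ⟨s, hs, hx, H⟩ := h x
      exact ⟨s, hs, hx, fun hf hf' => (H hf hf').2⟩

theorem isVecPseudoBundle_smoothAlong (l : ∀ b, E b →ₗ[ℝ] ℝ) :
    IsVecPseudoBundle (smoothAlong l) where
  proj _ hw := hw.1
  add q e₁ e₂ h₁ h₂ := ⟨h₁.1, by simpa using h₁.2.add h₂.2⟩
  smul q r e hr h := ⟨h.1, by simpa using hr.mul h.2⟩
  zero q hq := ⟨hq, by simpa using contDiff_const⟩

/-- A fibrewise linear function that is smooth on the generators of a dvsification is smooth. -/
theorem contDiff_of_isPlot_dvsification (l : ∀ b, E b →ₗ[ℝ] ℝ)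
    {g : Set ((n : ℕ) × (Euc n → Σ b, E b))}
    (hg : ∀ n p, (⟨n, p⟩ : (n : ℕ) × (Euc n → Σ b, E b)) ∈ g →
      IsPlot (fun a => (p a).1) ∧ ContDiff ℝ ∞ (fun a => l (p a).1 (p a).2))
    {n : ℕ} {w : Euc n → Σ b, E b}
    (hw : @IsPlot _ (dvsification (DiffeologicalSpace.generateFrom g)) _ w) :
    ContDiff ℝ ∞ (fun a => l (w a).1 (w a).2) :=
  -- `smoothAlong l` is one of the diffeologies whose infimum is the dvsification, so every plot of
  -- the latter is one of its plots.
  (DiffeologicalSpace.isPlot_sInf_iff.1 hw (smoothAlong l)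
    ⟨DiffeologicalSpace.generateFrom_le_iff.2 hg, isVecPseudoBundle_smoothAlong l⟩).2

end FibrewiseLinear

/-- A smooth fibrewise linear function, as a smooth section of the dual bundle. -/
def linearSection {B : Type u} [DiffeologicalSpace B] (E : VecPseudoBundle.{u, v} B)
    (l : ∀ b, E.Fibre b →ₗ[ℝ] ℝ)
    (hl : ∀ {n : ℕ} {w : Euc n → E.Total}, IsPlot w → ContDiff ℝ ∞ (fun a => l (w a).1 (w a).2)) :
    E.dual.sections :=
  ⟨fun x => ⟨l x, fun _ _ he => hl he⟩, fun _ _ hq => ⟨hq, fun _ _ _ _ he => hl he⟩⟩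

/-! ### Differentials of smooth functions -/

section Differential

variable {X : Type u} [DiffeologicalSpace X]

/-- The differential `T_x X → ℝ` of a smooth function. -/
def differential (φ : X → ℝ) (hφ : ∀ {n : ℕ} (p : Euc n → X), IsPlot p → ContDiff ℝ ∞ (φ ∘ p))
    (x : X) : InternalTangentSpace X x →ₗ[ℝ] ℝ :=
  open scoped Classical in
  (tangentRelations X x).liftQ
    (DFinsupp.lsum ℝ fun p : PointedPlot X x => (fderiv ℝ (φ ∘ p.toFun) 0).toLinearMap) <| by
  rw [tangentRelations, Submodule.span_le]
  rintro _ ⟨p, q, f, v, hf, h0, h, rfl⟩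
  have hq : DifferentiableAt ℝ (φ ∘ q.toFun) (f 0) :=
    ((hφ _ q.isPlot).differentiable (by simp)).differentiableAt
  have hf' : DifferentiableAt ℝ f 0 := (hf.differentiable (by simp)).differentiableAt
  -- The chain rule for `(φ ∘ q) ∘ f` is exactly the vanishing on a tangent relation.
  simp only [SetLike.mem_coe, LinearMap.mem_ker, map_sub, DFinsupp.lsum_single, ← h,
    ← Function.comp_assoc, fderiv_comp 0 hq hf', h0]
  simp

theorem differential_push (φ : X → ℝ)
    (hφ : ∀ {n : ℕ} (p : Euc n → X), IsPlot p → ContDiff ℝ ∞ (φ ∘ p)) {x : X}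
    (p : PointedPlot X x) (v : Euc p.dim) :
    differential φ hφ x (p.push v) = fderiv ℝ (φ ∘ p.toFun) 0 v := by
  classical
  simp only [differential, PointedPlot.push, LinearMap.comp_apply, Submodule.mkQ_apply,
    Submodule.liftQ_apply, DFinsupp.lsingle_apply]
  convert DFinsupp.lsum_single ℝ
    (fun q : PointedPlot X x => (fderiv ℝ (φ ∘ q.toFun) 0).toLinearMap) p v
  rfl

/-- On a generator `Tp ∘ (a, v)` the differential is the ordinary derivative of `φ ∘ p` at `a` along
`v`, which is smooth; generators suffice. -/
theorem contDiff_differential (φ : X → ℝ)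
    (hφ : ∀ {n : ℕ} (p : Euc n → X), IsPlot p → ContDiff ℝ ∞ (φ ∘ p)) {n : ℕ}
    {w : Euc n → (tangentBundle X).Total} (hw : IsPlot w) :
    ContDiff ℝ ∞ (fun a => differential φ hφ (w a).1 (w a).2) := by
  refine contDiff_of_isPlot_dvsification (differential φ hφ) ?_ hw
  rintro l w ⟨n, m, p, hp, a, v, ha, hv, h⟩
  cases h
  refine ⟨isPlot_reparam hp ha, ?_⟩
  have key : (fun c => differential φ hφ (p (a c)) (plotTangent p hp (a c) (v c))) =
      fun c => fderiv ℝ (φ ∘ p) (a c) (v c) := by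
    funext c
    refine (differential_push φ hφ (recentre p hp (a c)) (v c)).trans ?_
    change fderiv ℝ (fun b => (φ ∘ p) (b + a c)) 0 (v c) = _
    rw [fderiv_comp_add_right, zero_add]
  change ContDiff ℝ ∞ (fun c => differential φ hφ (p (a c)) (plotTangent p hp (a c) (v c)))
  rw [key]
  exact (((hφ p hp).fderiv_right (m := ∞) (by simp)).comp ha).clm_apply hv

/-- The 2-form `dφ ∧ dψ` as a family of alternating maps on the tangent spaces. -/
def wedgeDifferential (φ ψ : X → ℝ)
    (hφ : ∀ {n : ℕ} (p : Euc n → X), IsPlot p → ContDiff ℝ ∞ (φ ∘ p))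
    (hψ : ∀ {n : ℕ} (p : Euc n → X), IsPlot p → ContDiff ℝ ∞ (ψ ∘ p)) (x : X) :
    InternalTangentSpace X x [⋀^Fin 2]→ₗ[ℝ] ℝ :=
  (Matrix.detRowAlternating (n := Fin 2) (R := ℝ)).compLinearMap
    (LinearMap.pi ![differential φ hφ x, differential ψ hψ x])

theorem wedgeDifferential_apply (φ ψ : X → ℝ)
    (hφ : ∀ {n : ℕ} (p : Euc n → X), IsPlot p → ContDiff ℝ ∞ (φ ∘ p))
    (hψ : ∀ {n : ℕ} (p : Euc n → X), IsPlot p → ContDiff ℝ ∞ (ψ ∘ p)) (x : X)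
    (e : Fin 2 → InternalTangentSpace X x) :
    wedgeDifferential φ ψ hφ hψ x e =
      differential φ hφ x (e 0) * differential ψ hψ x (e 1) -
        differential ψ hψ x (e 0) * differential φ hφ x (e 1) := by
  exact (Matrix.det_fin_two (Matrix.of fun i =>
    LinearMap.pi ![differential φ hφ x, differential ψ hψ x] (e i))).trans (by simp)

/-- Generators suffice again: on a wedge of two tangent plots the value is a 2×2 determinant of
functions that are smooth by `contDiff_differential`. -/
theorem contDiff_wedgeDifferential (φ ψ : X → ℝ)
    (hφ : ∀ {n : ℕ} (p : Euc n → X), IsPlot p → ContDiff ℝ ∞ (φ ∘ p))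
    (hψ : ∀ {n : ℕ} (p : Euc n → X), IsPlot p → ContDiff ℝ ∞ (ψ ∘ p)) {n : ℕ}
    {w : Euc n → ((tangentBundle X).exterior 2).Total} (hw : IsPlot w) :
    ContDiff ℝ ∞ (fun a => exteriorPower.alternatingMapLinearEquiv
      (wedgeDifferential φ ψ hφ hψ (w a).1) (w a).2) := by
  refine contDiff_of_isPlot_dvsification (E := fun x => ⋀[ℝ]^2 (InternalTangentSpace X x))
    (fun x => exteriorPower.alternatingMapLinearEquiv (wedgeDifferential φ ψ hφ hψ x)) ?_ hw
  rintro l w ⟨n, q, e, hq, he, h⟩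
  cases h
  refine ⟨hq, ?_⟩
  have hx := fun i => contDiff_differential φ hφ (he i)
  have hy := fun i => contDiff_differential ψ hψ (he i)
  have key : (fun a => exteriorPower.alternatingMapLinearEquiv (wedgeDifferential φ ψ hφ hψ (q a))
      (exteriorPower.ιMulti ℝ 2 (e a))) = fun a =>
      differential φ hφ (q a) (e a 0) * differential ψ hψ (q a) (e a 1) -
        differential ψ hψ (q a) (e a 0) * differential φ hφ (q a) (e a 1) := by
    funext a
    exact (exteriorPower.alternatingMapLinearEquiv_apply_ιMulti _ _).trans
      (wedgeDifferential_apply φ ψ hφ hψ _ _)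
  change ContDiff ℝ ∞ (fun a => exteriorPower.alternatingMapLinearEquiv
    (wedgeDifferential φ ψ hφ hψ (q a)) (exteriorPower.ιMulti ℝ 2 (e a)))
  rw [key]
  exact ((hx 0).mul (hy 1)).sub ((hy 0).mul (hx 1))

/-- The 2-form `dφ ∧ dψ` as a smooth section of the dual of `⋀² TX`. -/
def wedgeForm (φ ψ : X → ℝ)
    (hφ : ∀ {n : ℕ} (p : Euc n → X), IsPlot p → ContDiff ℝ ∞ (φ ∘ p))
    (hψ : ∀ {n : ℕ} (p : Euc n → X), IsPlot p → ContDiff ℝ ∞ (ψ ∘ p)) : TangentForms 2 X :=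
  linearSection ((tangentBundle X).exterior 2)
    (fun x => exteriorPower.alternatingMapLinearEquiv (wedgeDifferential φ ψ hφ hψ x))
    fun hw => contDiff_wedgeDifferential φ ψ hφ hψ hw

theorem wedgeForm_apply (φ ψ : X → ℝ)
    (hφ : ∀ {n : ℕ} (p : Euc n → X), IsPlot p → ContDiff ℝ ∞ (φ ∘ p))
    (hψ : ∀ {n : ℕ} (p : Euc n → X), IsPlot p → ContDiff ℝ ∞ (ψ ∘ p)) (x : X)
    (e : Fin 2 → InternalTangentSpace X x) :
    ((wedgeForm φ ψ hφ hψ).1 x).1 (exteriorPower.ιMulti ℝ 2 e) =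
      differential φ hφ x (e 0) * differential ψ hψ x (e 1) -
        differential ψ hψ x (e 0) * differential φ hφ x (e 1) :=
  (exteriorPower.alternatingMapLinearEquiv_apply_ιMulti _ _).trans
    (wedgeDifferential_apply φ ψ hφ hψ _ _)

/-- A colimit of vector spaces is spanned by the images of its structure maps. -/
theorem InternalTangentSpace.eq_top_of_push_mem {x : X}
    {W : Submodule ℝ (InternalTangentSpace X x)}
    (h : ∀ (p : PointedPlot X x) (v : Euc p.dim), p.push v ∈ W) : W = ⊤ := by
  classical
  refine eq_top_iff.2 fun z _ => ?_
  obtain ⟨y, rfl⟩ := Submodule.mkQ_surjective _ z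
  clear * - h
  induction y using DFinsupp.induction with
  | h0 => simp
  | ha p v y _ _ ih =>
    rw [map_add]
    refine W.add_mem ?_ ih
    exact h p v

end Differential

/-- The identification of `ℝ` with `ℝ¹`. -/
def realToEuc (t : ℝ) : Euc 1 := WithLp.toLp 2 fun _ => t

theorem realToEuc_apply (t : ℝ) (i : Fin 1) : realToEuc t i = t := rfl

theorem realToEuc_zero : realToEuc 0 = 0 := rfl

theorem contDiff_realToEuc : ContDiff ℝ ∞ realToEuc := contDiff_euclidean.2 fun _ => contDiff_id

/-! ### Plots of the glued axes -/

namespace GluedAxes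

/-- The first coordinate. -/
def fst (z : GluedAxes) : ℝ := z.1.1

/-- The second coordinate. -/
def snd (z : GluedAxes) : ℝ := z.1.2

theorem fst_eq_zero_or_snd_eq_zero (z : GluedAxes) : z.fst = 0 ∨ z.snd = 0 := z.2

theorem ext {z w : GluedAxes} (h₁ : z.fst = w.fst) (h₂ : z.snd = w.snd) : z = w :=
  Subtype.ext (Prod.ext h₁ h₂)

theorem inl_fst {z : GluedAxes} (h : z.snd = 0) : inl z.fst = z := ext rfl h.symm

theorem inr_snd {z : GluedAxes} (h : z.fst = 0) : inr z.snd = z := ext h.symm rfl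

/-- The diffeology of maps with smooth coordinates, one of which vanishes locally. -/
@[reducible]
def locallyAxial : DiffeologicalSpace GluedAxes where
  plots _ := {p | ContDiff ℝ ∞ (fst ∘ p) ∧ ContDiff ℝ ∞ (snd ∘ p) ∧
    ∀ a, (∀ᶠ c in 𝓝 a, (p c).snd = 0) ∨ ∀ᶠ c in 𝓝 a, (p c).fst = 0}
  constant_plots z := ⟨contDiff_const, contDiff_const, fun _ => z.fst_eq_zero_or_snd_eq_zero.symm.imp
    (fun h => Filter.Eventually.of_forall fun _ => h)
    (fun h => Filter.Eventually.of_forall fun _ => h)⟩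
  plot_reparam {_ _ _ f} hp hf := ⟨hp.1.comp hf, hp.2.1.comp hf, fun a =>
    (hp.2.2 (f a)).imp hf.continuous.continuousAt.eventually hf.continuous.continuousAt.eventually⟩
  locality {n p} h := by
    refine ⟨contDiff_of_locally fun x => ?_, contDiff_of_locally fun x => ?_, fun a => ?_⟩
    · obtain ⟨s, hs, hx, H⟩ := h x
      exact ⟨s, hs, hx, fun hf hf' => (H hf hf').1⟩
    · obtain ⟨s, hs, hx, H⟩ := h x
      exact ⟨s, hs, hx, fun hf hf' => (H hf hf').2.1⟩
    · obtain ⟨s, hs, hx, H⟩ := h a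
      -- The vanishing condition is known only for `p ∘ f`; it passes to `p` because `f` is the
      -- identity near `a`.
      obtain ⟨f, hf, hfs, hfa⟩ := exists_contDiff_eventuallyEq_id a (hs.mem_nhds hx)
      refine ((H hfs hf).2.2 a).imp (fun hp => ?_) (fun hp => ?_) <;>
      · filter_upwards [hp, hfa] with c hc hc'
        simpa [hc'] using hc

/-- The gluing diffeology is the smallest one containing the two axes, and both are plots of
`locallyAxial`. The last clause excludes smooth curves in the plane that switch axes at the origin
by becoming flat there. -/
theorem mem_locallyAxial {n : ℕ} {p : Euc n → GluedAxes} (hp : IsPlot p) :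
    ContDiff ℝ ∞ (fst ∘ p) ∧ ContDiff ℝ ∞ (snd ∘ p) ∧
      ∀ a, (∀ᶠ c in 𝓝 a, (p c).snd = 0) ∨ ∀ᶠ c in 𝓝 a, (p c).fst = 0 := by
  have h : instDiffeologicalSpaceGluedAxes ≤ locallyAxial := by
    refine DiffeologicalSpace.generateFrom_le_iff.2 fun n p hp => ?_
    have h0 : ContDiff ℝ ∞ fun t : Euc 1 => t 0 := by fun_prop
    rcases hp with h | h <;> cases h
    · exact ⟨h0, contDiff_const, fun _ => Or.inl (Filter.Eventually.of_forall fun _ => rfl)⟩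
    · exact ⟨contDiff_const, h0, fun _ => Or.inr (Filter.Eventually.of_forall fun _ => rfl)⟩
  exact DiffeologicalSpace.le_iff'.1 h n p hp

theorem contDiff_fst {n : ℕ} (p : Euc n → GluedAxes) (hp : IsPlot p) : ContDiff ℝ ∞ (fst ∘ p) :=
  (mem_locallyAxial hp).1

theorem contDiff_snd {n : ℕ} (p : Euc n → GluedAxes) (hp : IsPlot p) : ContDiff ℝ ∞ (snd ∘ p) :=
  (mem_locallyAxial hp).2.1

theorem isPlot_inl : IsPlot fun t : Euc 1 => inl (t 0) :=
  DiffeologicalSpace.isPlot_generatedFrom_of_mem (Or.inl rfl)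

theorem isPlot_inr : IsPlot fun t : Euc 1 => inr (t 0) :=
  DiffeologicalSpace.isPlot_generatedFrom_of_mem (Or.inr rfl)

/-- After a reparametrisation that is the identity near a given point, a plot lies in one axis. -/
theorem exists_reparam {n : ℕ} {p : Euc n → GluedAxes} (hp : IsPlot p) (a : Euc n) :
    ∃ f : Euc n → Euc n, ContDiff ℝ ∞ f ∧ f a = a ∧ fderiv ℝ f a = ContinuousLinearMap.id ℝ _ ∧
      ((∀ c, (p (f c)).snd = 0) ∨ ∀ c, (p (f c)).fst = 0) := by
  rcases (mem_locallyAxial hp).2.2 a with h | h <;>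
  obtain ⟨f, hf, hfU, hfa⟩ := exists_contDiff_eventuallyEq_id a h
  · exact ⟨f, hf, hfa.eq_of_nhds, hfa.fderiv_eq.trans fderiv_id, Or.inl hfU⟩
  · exact ⟨f, hf, hfa.eq_of_nhds, hfa.fderiv_eq.trans fderiv_id, Or.inr hfU⟩

/-! ### Tangent spaces of the glued axes -/

/-- The first axis, centred at one of its points. -/
def axis₁ (z : GluedAxes) (h : z.snd = 0) : PointedPlot GluedAxes z where
  dim := 1
  toFun t := inl (t 0 + z.fst)
  isPlot := isPlot_reparam (f := fun t : Euc 1 => t + realToEuc z.fst) isPlot_inl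
    (contDiff_id.add contDiff_const)
  map_zero := by simpa using inl_fst h

/-- The second axis, centred at one of its points. -/
def axis₂ (z : GluedAxes) (h : z.fst = 0) : PointedPlot GluedAxes z where
  dim := 1
  toFun t := inr (t 0 + z.snd)
  isPlot := isPlot_reparam (f := fun t : Euc 1 => t + realToEuc z.snd) isPlot_inr
    (contDiff_id.add contDiff_const)
  map_zero := by simpa using inr_snd h

/-- The tangent vector of the first axis. -/
def tangent₁ (z : GluedAxes) (h : z.snd = 0) : InternalTangentSpace GluedAxes z :=
  (axis₁ z h).push (realToEuc 1)

/-- The tangent vector of the second axis. -/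
def tangent₂ (z : GluedAxes) (h : z.fst = 0) : InternalTangentSpace GluedAxes z :=
  (axis₂ z h).push (realToEuc 1)

theorem push_mem_span_of_dim_eq_one {X : Type u} [DiffeologicalSpace X] {x : X} {f : Euc 1 → X}
    (hf : IsPlot f) (h0 : f 0 = x) (v : Euc 1) :
    (PointedPlot.mk 1 f hf h0).push v ∈
      ℝ ∙ (PointedPlot.mk 1 f hf h0).push (realToEuc 1) := by
  refine Submodule.mem_span_singleton.2 ⟨v 0, ?_⟩
  rw [← map_smul]
  congr 1
  ext i
  fin_cases i
  exact mul_one (v 0)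

/-- Tangent vectors depend only on germs of plots, and each germ factors through one axis. That axis
must contain `z`, which is what the existential proofs record. -/
theorem push_mem_span {z : GluedAxes} (p : PointedPlot GluedAxes z) (v : Euc p.dim) :
    (∃ h, p.push v ∈ ℝ ∙ tangent₁ z h) ∨ ∃ h, p.push v ∈ ℝ ∙ tangent₂ z h := by
  obtain ⟨f, hf, h0, hd, H⟩ := exists_reparam p.isPlot 0
  have hpf : IsPlot (p.toFun ∘ f) := isPlot_reparam p.isPlot hf
  let p' : PointedPlot GluedAxes z := ⟨p.dim, p.toFun ∘ f, hpf,
    by rw [Function.comp_apply, h0, p.map_zero]⟩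
  -- `f` is a morphism from `p'` to `p` whose derivative at 0 is the identity.
  have hp' : p'.push v = p.push v := by
    rw [PointedPlot.push_comp p' p f hf h0 rfl v, hd]
    rfl
  have hz : p.toFun (f 0) = z := by rw [h0, p.map_zero]
  rw [← hp']
  refine H.imp (fun H => ⟨hz ▸ H 0, ?_⟩) (fun H => ⟨hz ▸ H 0, ?_⟩)
  · rw [PointedPlot.push_comp p' (axis₁ z (hz ▸ H 0))
      (fun c => realToEuc ((p.toFun (f c)).fst - z.fst)) ?_ ?_ ?_ v]
    · exact push_mem_span_of_dim_eq_one _ _ _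
    · exact contDiff_realToEuc.comp ((contDiff_fst _ hpf).sub contDiff_const)
    · exact (congrArg realToEuc (sub_eq_zero.2 (congrArg fst hz))).trans realToEuc_zero
    · funext c
      exact (congrArg inl (sub_add_cancel _ _)).trans (inl_fst (H c))
  · rw [PointedPlot.push_comp p' (axis₂ z (hz ▸ H 0))
      (fun c => realToEuc ((p.toFun (f c)).snd - z.snd)) ?_ ?_ ?_ v]
    · exact push_mem_span_of_dim_eq_one _ _ _
    · exact contDiff_realToEuc.comp ((contDiff_snd _ hpf).sub contDiff_const)
    · exact (congrArg realToEuc (sub_eq_zero.2 (congrArg snd hz))).trans realToEuc_zero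
    · funext c
      exact (congrArg inr (sub_add_cancel _ _)).trans (inr_snd (H c))

/-- Away from the origin only one axis passes through `z`, so the other alternative of
`push_mem_span` is void. -/
theorem span_tangent₁_eq_top {z : GluedAxes} (hz : z.fst ≠ 0) (h : z.snd = 0) :
    ℝ ∙ tangent₁ z h = ⊤ :=
  InternalTangentSpace.eq_top_of_push_mem fun p v =>
    (push_mem_span p v).elim (fun ⟨_, hm⟩ => hm) (fun ⟨h', _⟩ => (hz h').elim)

theorem span_tangent₂_eq_top {z : GluedAxes} (hz : z.snd ≠ 0) (h : z.fst = 0) :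
    ℝ ∙ tangent₂ z h = ⊤ :=
  InternalTangentSpace.eq_top_of_push_mem fun p v =>
    (push_mem_span p v).elim (fun ⟨h', _⟩ => (hz h').elim) (fun ⟨_, hm⟩ => hm)

theorem span_tangents_eq_top {z : GluedAxes} (h₁ : z.snd = 0) (h₂ : z.fst = 0) :
    Submodule.span ℝ {tangent₁ z h₁, tangent₂ z h₂} = ⊤ :=
  InternalTangentSpace.eq_top_of_push_mem fun p v =>
    (push_mem_span p v).elim
      (fun ⟨_, hm⟩ => Submodule.span_mono (by simp) hm)
      (fun ⟨_, hm⟩ => Submodule.span_mono (by simp) hm)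

/-! ### Forms on the glued axes -/

/-- The origin. -/
def origin : GluedAxes := inl 0

/-- The section `dx ∧ dy`. -/
def areaForm : TangentForms 2 GluedAxes := wedgeForm fst snd contDiff_fst contDiff_snd

theorem areaForm_tangents :
    (areaForm.1 origin).1 (exteriorPower.ιMulti ℝ 2 ![tangent₁ origin rfl, tangent₂ origin rfl])
      = 1 := by
  refine (wedgeForm_apply _ _ _ _ _ _).trans ?_
  have hd : ∀ r : ℝ, fderiv ℝ (fun t : Euc 1 => t 0 + r) 0 (realToEuc 1) = 1 := by
    intro r
    rw [fderiv_add_const]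
    exact congrArg (fun l => l (realToEuc 1)) (EuclideanSpace.proj (𝕜 := ℝ) (0 : Fin 1)).fderiv
  have h11 : differential fst contDiff_fst origin (tangent₁ origin rfl) = 1 :=
    (differential_push _ _ _ _).trans (hd origin.fst)
  have h22 : differential snd contDiff_snd origin (tangent₂ origin rfl) = 1 :=
    (differential_push _ _ _ _).trans (hd origin.snd)
  have h12 : differential snd contDiff_snd origin (tangent₁ origin rfl) = 0 :=
    (differential_push _ _ _ _).trans
      (congrArg (fun l => l (realToEuc 1)) (fderiv_const_apply (𝕜 := ℝ) (E := Euc 1) (0 : ℝ)))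
  change differential fst contDiff_fst origin (tangent₁ origin rfl) *
    differential snd contDiff_snd origin (tangent₂ origin rfl) -
      differential snd contDiff_snd origin (tangent₁ origin rfl) *
        differential fst contDiff_fst origin (tangent₂ origin rfl) = 1
  -- The value of `dx` on `tangent₂` is not needed, since its cofactor is zero.
  rw [h11, h12, h22, mul_one, zero_mul, sub_zero]

/-- An alternating map in two variables vanishes if it does on a pair of generators. -/
theorem alternatingMap_eq_zero {M : Type*} [AddCommGroup M] [Module ℝ M] {a b : M}
    (h : Submodule.span ℝ {a, b} = ⊤) (g : M [⋀^Fin 2]→ₗ[ℝ] ℝ) (hg : g ![a, b] = 0) : g = 0 := by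
  ext e
  obtain ⟨r, s, h0⟩ := Submodule.mem_span_pair.1 (h ▸ Submodule.mem_top : e 0 ∈ _)
  obtain ⟨t, w, h1⟩ := Submodule.mem_span_pair.1 (h ▸ Submodule.mem_top : e 1 ∈ _)
  have he : e = ![r • a + s • b, t • a + w • b] := by
    ext i
    fin_cases i <;> simp [h0, h1]
  have hl : ∀ (x y m : M) (c d : ℝ), g ![c • x + d • y, m] = c * g ![x, m] + d * g ![y, m] := by
    intro x y m c d
    exact (g.map_vecCons_add ![m] _ _).trans
      (congrArg₂ _ (g.map_vecCons_smul ![m] _ _) (g.map_vecCons_smul ![m] _ _))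
  have hs : ∀ x y : M, g ![x, y] = - g ![y, x] := by
    intro x y
    have := g.map_swap ![y, x] (show (0 : Fin 2) ≠ 1 by decide)
    rw [← this]
    congr 1
    ext i
    fin_cases i <;> simp
  have hz : ∀ x : M, g ![x, x] = 0 := fun x =>
    g.map_eq_zero_of_eq ![x, x] (i := 0) (j := 1) rfl (by decide)
  -- Swapping the arguments lets linearity in the first slot expand the second; only multiples of `g
  -- ![a, b]` survive.
  rw [he, hl, hs a, hs b, hl, hl, hz, hz, hs b a, hg]
  simp

/-- At the origin the two axis directions generate, so the hypothesis kills `s` there. Elsewhere the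
tangent space is a line and its exterior square is zero. -/
theorem tangentForm_eq_zero {s : TangentForms 2 GluedAxes}
    (hs : (s.1 origin).1
      (exteriorPower.ιMulti ℝ 2 ![tangent₁ origin rfl, tangent₂ origin rfl]) = 0) : s = 0 := by
  refine Subtype.ext (funext fun z => Subtype.ext (exteriorPower.linearMap_ext ?_))
  refine Eq.trans ?_ (LinearMap.zero_compAlternatingMap _).symm
  by_cases h₁ : z.snd = 0
  · by_cases h₂ : z.fst = 0
    · obtain rfl : z = origin := ext h₂ h₁
      exact alternatingMap_eq_zero (span_tangents_eq_top h₁ h₂) _ hs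
    -- Repeating the single generator reduces the line case to the case of a pair, where alternation
    -- gives the vanishing.
    · refine alternatingMap_eq_zero (a := tangent₁ z h₁) (b := tangent₁ z h₁) ?_ _
        (AlternatingMap.map_eq_zero_of_eq _ _ (i := 0) (j := 1) rfl (by decide))
      rw [Set.pair_eq_singleton]
      exact span_tangent₁_eq_top h₂ h₁
  · have h₂ : z.fst = 0 := z.fst_eq_zero_or_snd_eq_zero.resolve_right h₁
    refine alternatingMap_eq_zero (a := tangent₂ z h₂) (b := tangent₂ z h₂) ?_ _
        (AlternatingMap.map_eq_zero_of_eq _ _ (i := 0) (j := 1) rfl (by decide))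
    rw [Set.pair_eq_singleton]
    exact span_tangent₂_eq_top h₁ h₂

theorem finrank_tangentForms : Module.finrank ℝ (TangentForms 2 GluedAxes) = 1 := by
  refine finrank_eq_one areaForm (fun h => ?_) fun s => ?_
  · have := areaForm_tangents
    rw [h] at this
    exact zero_ne_one this
  · refine ⟨(s.1 origin).1
      (exteriorPower.ιMulti ℝ 2 ![tangent₁ origin rfl, tangent₂ origin rfl]), ?_⟩
    -- The difference between `s` and its multiple of `areaForm` vanishes on the distinguished
    -- wedge, where `areaForm` is 1.
    refine (sub_eq_zero.1 (tangentForm_eq_zero ?_)).symm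
    set W := exteriorPower.ιMulti ℝ 2 ![tangent₁ origin rfl, tangent₂ origin rfl] with hW
    change (s.1 origin).1 W - (s.1 origin).1 W * (areaForm.1 origin).1 W = 0
    have h : (areaForm.1 origin).1 W = 1 := areaForm_tangents
    exact (congrArg (fun r => (s.1 origin).1 W - (s.1 origin).1 W * r) h).trans (by simp)

/-- By compatibility `α` at `p` is pulled back from a 2-form on `ℝ¹`, where any two vectors are
linearly dependent. -/
theorem differentialForm_apply_eq_zero_of_factor (α : DifferentialForms 2 GluedAxes)
    {q : Euc 1 → GluedAxes} (hq : IsPlot q) (p : Plot GluedAxes) {g : Euc p.dim → ℝ}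
    (hg : ContDiff ℝ ∞ g)
    (h : ∀ c, q (realToEuc (g c)) = p.toFun c) (a : Euc p.dim) : α.1 p a = 0 := by
  rw [← α.2.2 p ⟨1, q, hq⟩ (fun c => realToEuc (g c)) ?_ (funext h)]
  · ext v
    refine ((α.1 ⟨1, q, hq⟩ _).toAlternatingMap.map_linearDependent (K := ℝ) _ fun hv => ?_)
    have := hv.fintype_card_le_finrank
    simp at this
  · exact contDiff_realToEuc.comp hg

theorem differentialForm_eq_zero (α : DifferentialForms 2 GluedAxes) : α = 0 := by
  refine Subtype.ext (funext fun p => funext fun a => ?_)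
  obtain ⟨f, hf, h0, hd, H⟩ := exists_reparam p.isPlot a
  let p' : Plot GluedAxes := ⟨p.dim, p.toFun ∘ f, isPlot_reparam p.isPlot hf⟩
  -- Since `f` fixes `a` with identity derivative there, pulling back along it does not change the
  -- value at `a`.
  have key : α.1 p' a = α.1 p a := by
    rw [← α.2.2 p' p f hf rfl a, hd, h0]
    rfl
  rw [← key]
  rcases H with H | H
  · exact differentialForm_apply_eq_zero_of_factor α isPlot_inl p' (contDiff_fst _ p'.isPlot)
      (fun c => inl_fst (H c)) a
  · exact differentialForm_apply_eq_zero_of_factor α isPlot_inr p' (contDiff_snd _ p'.isPlot)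
      (fun c => inr_snd (H c)) a

/-! ### Failure of the filteredness condition -/

/-- A property that holds along `q` near the base point holds along every pointed plot that locally
factors through `q`. -/
theorem eventually_of_factor {X : Type u} [DiffeologicalSpace X] {x : X} {p q : PointedPlot X x}
    {P : X → Prop} (hq : ∀ᶠ c in 𝓝 0, P (q.toFun c))
    (h : ∃ (U : Set (Euc p.dim)) (f : Euc p.dim → Euc q.dim), IsOpen U ∧ 0 ∈ U ∧
      ContDiffOn ℝ ∞ f U ∧ f 0 = 0 ∧ ∀ a ∈ U, q.toFun (f a) = p.toFun a) :
    ∀ᶠ c in 𝓝 0, P (p.toFun c) := by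
  obtain ⟨U, f, hU, h0, hf, hf0, hqf⟩ := h
  have hc : Filter.Tendsto f (𝓝 0) (𝓝 0) := by
    simpa [hf0] using (hf.continuousOn.continuousAt (hU.mem_nhds h0)).tendsto
  filter_upwards [hc.eventually hq, hU.mem_nhds h0] with c hc' hcU
  rwa [← hqf c hcU]

/-- The summand 0 is the coordinate of the origin in `axis₁` and `axis₂`, so the statement applies
to them by unfolding. -/
theorem not_eventually_coord_eq_zero : ¬ ∀ᶠ c : Euc 1 in 𝓝 0, c 0 + 0 = 0 := by
  intro h
  have hc : Filter.Tendsto realToEuc (𝓝 0) (𝓝 0) :=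
    contDiff_realToEuc.continuous.tendsto 0
  obtain ⟨r, hr, H⟩ := Metric.eventually_nhds_iff.1 (hc.eventually h)
  have := H (y := r / 2) (by simp [abs_of_pos hr, hr])
  simp [realToEuc_apply] at this
  exact hr.ne' this

/-- A common plot for both axes would lie in one axis near 0, and the other axis, factoring through
it, would be constant near 0. -/
theorem not_weaklyFiltered : ¬ WeaklyFiltered GluedAxes := by
  classical
  intro h
  obtain ⟨q, hq⟩ := h origin {axis₁ origin rfl, axis₂ origin rfl}
  rcases (mem_locallyAxial q.isPlot).2.2 0 with h | h
  · exact not_eventually_coord_eq_zero (eventually_of_factor (p := axis₂ origin rfl)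
      (P := fun z => z.snd = 0) h (hq (axis₂ origin rfl) (by simp)))
  · exact not_eventually_coord_eq_zero (eventually_of_factor (p := axis₁ origin rfl)
      (P := fun z => z.fst = 0) h (hq (axis₁ origin rfl) (by simp)))

theorem not_injective_of_differentialForms
    (L : TangentForms 2 GluedAxes →ₗ[ℝ] DifferentialForms 2 GluedAxes) :
    ¬ Function.Injective L := by
  intro h
  have : Subsingleton (TangentForms 2 GluedAxes) := ⟨fun a b => h <| by
    rw [differentialForm_eq_zero (L a), differentialForm_eq_zero (L b)]⟩
  exact zero_ne_one (Module.finrank_zero_of_subsingleton.symm.trans finrank_tangentForms)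

end GluedAxes

end Diffeology

end

theorem proposition5p8 :
    Module.finrank ℝ (Diffeology.TangentForms 2 Diffeology.GluedAxes) = 1 ∧
    (∀ α : Diffeology.DifferentialForms 2 Diffeology.GluedAxes, α = 0) ∧
    (¬ ∃ L : Diffeology.TangentForms 2 Diffeology.GluedAxes →ₗ[ℝ]
        Diffeology.DifferentialForms 2 Diffeology.GluedAxes, Function.Injective L) ∧
    ¬ Diffeology.WeaklyFiltered Diffeology.GluedAxes ∧
    ¬ Function.Injective (Diffeology.comparison 2 Diffeology.GluedAxes) :=
  ⟨Diffeology.GluedAxes.finrank_tangentForms, Diffeology.GluedAxes.differentialForm_eq_zero,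
    fun ⟨L, hL⟩ => Diffeology.GluedAxes.not_injective_of_differentialForms L hL,
    Diffeology.GluedAxes.not_weaklyFiltered,
    Diffeology.GluedAxes.not_injective_of_differentialForms _⟩
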